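/- All schemes are assumed to be locally Noetherian. For a scheme $X$, let $\operatorname{Ass} X$ be the set of associated points of $X$, that is, of those $x\in X$ for which the maximal ideal $\mathfrak{m}_{X,x}$ is an associated prime of the local ring $\mathcal{O}_{X,x}$. Let $i\colon \operatorname{Ass} X\to X$ be the inclusion, where $\operatorname{Ass} X$ carries the subspace topology, and let $\mathcal{Q}_X:=i_*i^{-1}\mathcal{O}_X$ be the sheaf of rational functions on $X$, with its natural morphism $\mathcal{O}_X\to\mathcal{Q}_X$. A morphism of schemes $f\colon Y\to X$ is called bifractional if there is a morphism of sheaves of rings $f^{-1}\mathcal{Q}_X\to\mathcal{Q}_Y$ that forms a commutative square with $f^\#\colon f^{-1}\mathcal{O}_X\to\mathcal{O}_Y$ and the natural morphisms $f^{-1}\mathcal{O}_X\to f^{-1}\mathcal{Q}_X$ and $\mathcal{O}_Y\to\mathcal{Q}_Y$, and whose adjoint $\mathcal{Q}_X\to f_*\mathcal{Q}_Y$ is an isomorphism. \textbf{Proposition.} Let $X$ be a reduced Cohen--Macaulay scheme, and let $f\colon Y\to X$ be a finite bifractional morphism of schemes. Then $f$ is equidimensional along fibers of closed points: for every closed point $x\in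 X$, the Krull dimension $\dim\mathcal{O}_{Y,y}$ is the same for all $y\in f^{-1}(x)$. -/

import Mathlib

open CategoryTheory TopologicalSpace AlgebraicGeometry

universe u

noncomputable section

/-- The depth of a local ring: the supremum of the lengths of the regular sequences contained in
the maximal ideal. -/
def localDepth (R : Type u) [CommRing R] [IsLocalRing R] : WithBot ℕ∞ :=
  ⨆ (rs : List R) (_ : (∀ r ∈ rs, r ∈ IsLocalRing.maximalIdeal R) ∧
    RingTheory.Sequence.IsRegular R rs), ((rs.length : ℕ∞) : WithBot ℕ∞)

/-- A Cohen-Macaulay scheme: it is locally Noetherian, and all its local rings have depth equal to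
their Krull dimension. -/
class IsCohenMacaulayScheme (X : Scheme.{u}) : Prop extends IsLocallyNoetherian X where
  depth_eq_dim : ∀ x : X, localDepth (X.presheaf.stalk x) = ringKrullDim (X.presheaf.stalk x)

/-- The associated points of `X`: the points `x` whose maximal ideal in the local ring at `x` is an
associated prime of that ring. -/
def assPoints (X : Scheme.{u}) : Set X :=
  {x | IsLocalRing.maximalIdeal (X.presheaf.stalk x) ∈
    associatedPrimes (X.presheaf.stalk x) (X.presheaf.stalk x)}

/-- The inclusion of the associated points, with the subspace topology, as a continuous map. -/
def assInclusion (X : Scheme.{u}) : TopCat.of (assPoints X) ⟶ TopCat.of X :=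
  TopCat.ofHom ⟨Subtype.val, continuous_subtype_val⟩

/-- The sheaf of rational functions `i_* i⁻¹ 𝒪_X`, for `i` the inclusion of the associated points
of `X`. -/
def ratSheaf (X : Scheme.{u}) : TopCat.Sheaf CommRingCat.{u} (TopCat.of X) :=
  (TopCat.Sheaf.pushforward CommRingCat.{u} (assInclusion X)).obj
    ((TopCat.Sheaf.pullback CommRingCat.{u} (assInclusion X)).obj X.sheaf)

/-- The natural morphism from `𝒪_X` to the sheaf of rational functions. -/
def toRatSheaf (X : Scheme.{u}) : X.sheaf ⟶ ratSheaf X :=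
  (TopCat.Sheaf.pullbackPushforwardAdjunction CommRingCat.{u} (assInclusion X)).unit.app X.sheaf

/-- The morphism of sheaves of rings `𝒪_X ⟶ f_* 𝒪_Y` given by `f : Y ⟶ X`. -/
def structureMap {X Y : Scheme.{u}} (f : Y ⟶ X) :
    X.sheaf ⟶ (TopCat.Sheaf.pushforward CommRingCat.{u} f.base).obj Y.sheaf :=
  ⟨f.c⟩

/-- The adjoint form `f⁻¹ 𝒪_X ⟶ 𝒪_Y` of `structureMap f`. -/
def structureMapAdj {X Y : Scheme.{u}} (f : Y ⟶ X) :
    (TopCat.Sheaf.pullback CommRingCat.{u} f.base).obj X.sheaf ⟶ Y.sheaf :=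
  ((TopCat.Sheaf.pullbackPushforwardAdjunction CommRingCat.{u} f.base).homEquiv _ _).symm
    (structureMap f)

/-- `ψ : f⁻¹ 𝒬_X ⟶ 𝒬_Y` is induced by `f`, that is, the square formed by `ψ`, by
`f⁻¹ 𝒪_X ⟶ 𝒪_Y` and by the natural maps to the rational functions commutes. -/
def IsInducedOnRat {X Y : Scheme.{u}} (f : Y ⟶ X)
    (ψ : (TopCat.Sheaf.pullback CommRingCat.{u} f.base).obj (ratSheaf X) ⟶ ratSheaf Y) : Prop :=
  (TopCat.Sheaf.pullback CommRingCat.{u} f.base).map (toRatSheaf X) ≫ ψ =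
    structureMapAdj f ≫ toRatSheaf Y

/-- `f : Y ⟶ X` is bifractional: it induces a morphism `f⁻¹ 𝒬_X ⟶ 𝒬_Y` of sheaves of rings
(that is, it is fractional) whose adjoint `𝒬_X ⟶ f_* 𝒬_Y` is an isomorphism. -/
def IsBifractional {X Y : Scheme.{u}} (f : Y ⟶ X) : Prop :=
  ∃ ψ : (TopCat.Sheaf.pullback CommRingCat.{u} f.base).obj (ratSheaf X) ⟶ ratSheaf Y,
    IsInducedOnRat f ψ ∧
      IsIso ((TopCat.Sheaf.pullbackPushforwardAdjunction CommRingCat.{u} f.base).homEquiv _ _ ψ)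

/-- `f : Y ⟶ X` is equidimensional along fibers of closed points: for each closed point `x` of `X`,
the dimension of the local ring of `Y` at `y` is the same for all `y` over `x`. -/
def IsEquidimAlongClosedFibers {X Y : Scheme.{u}} (f : Y ⟶ X) : Prop :=
  ∀ x : X, IsClosed ({x} : Set X) → ∀ y y' : Y, f y = x → f y' = x →
    ringKrullDim (Y.presheaf.stalk y) = ringKrullDim (Y.presheaf.stalk y')

end

/-!
Let `A` be a reduced Noetherian ring with Cohen-Macaulay local rings and `B` a finite `A`-algebra
inside the total ring of fractions of `A`. The claim is that a prime `q` of `B` over `p` has the same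
height as `p`. Integrality gives `ht q ≤ ht p`. For the converse let `d = ht p`, let `x₁, …, x_d` be a
regular sequence in `A_p`, and suppose `ht q < d`.

The Krull boundary of `x` modulo an ideal `I` is `xR + (I : x^∞)`. A prime containing it is not
minimal over `I`, so a prime containing the iterated boundary of the zero ideal along `d` elements has
height at least `d` (`iterBoundary_le_exists_height`). Hence the iterated boundary in `B` along the
powers `x₁ⁿ, …, x_dⁿ` contains some `s ∉ q`. A common denominator `a` of `B` defines an `A`-linear
map `φ : B → A`, multiplication by `a`, and iterated boundaries are compatible with linear maps. As
the powers `xᵢⁿ` again form a regular sequence, the iterated boundary in `A_p` is just the ideal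
generated by them (`iterBoundary_pow_le`), so that `a s` lies in `qⁿ B_q`, and hence so does `a`.
This holds for all `n`, so `a` vanishes in `B_q` by Krull's intersection theorem, although it is
regular on `B` (`height_le_height_of_isRegular`). No universal catenarity or completion is needed.

To reach this algebraic situation, the stalks of `i⁻¹ 𝒪_X` are identified with those of `𝒪_X`
(`isIso_adjStalkMap_unit`). A rational function is therefore determined by its values in the local
rings at the associated points (`ratValue_ext`). On an affine open set regular functions embed into
rational functions (`toRat_injective`). If the scheme is reduced, the maximal ideals at associated
points vanish, and rational functions are fractions with nonzerodivisors as denominators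
(`exists_nonZeroDivisors_toRat_mul_eq`). A bifractional morphism identifies the rational functions on
`U` and on its preimage, which embeds `B = Γ(Y, f⁻¹ U)` into the fractions of `A = Γ(X, U)`.
-/

/-! ### Iterated boundary ideals -/

section Boundary

variable {R : Type*} [CommRing R]

/-- The saturation `(I : x^∞)` of an ideal `I` by the powers of an element `x`. -/
def powSaturation (I : Ideal R) (x : R) : Ideal R where
  carrier := {y | ∃ k : ℕ, x ^ k * y ∈ I}
  zero_mem' := ⟨0, by simp⟩
  add_mem' := by
    rintro y z ⟨k, hk⟩ ⟨l, hl⟩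
    refine ⟨k + l, ?_⟩
    have h : x ^ (k + l) * (y + z) = x ^ l * (x ^ k * y) + x ^ k * (x ^ l * z) := by ring
    rw [h]
    exact I.add_mem (I.mul_mem_left _ hk) (I.mul_mem_left _ hl)
  smul_mem' := by
    rintro c y ⟨k, hk⟩
    refine ⟨k, ?_⟩
    rw [smul_eq_mul, mul_left_comm]
    exact I.mul_mem_left _ hk

theorem mem_powSaturation {I : Ideal R} {x y : R} :
    y ∈ powSaturation I x ↔ ∃ k : ℕ, x ^ k * y ∈ I := Iff.rfl

theorem le_powSaturation (I : Ideal R) (x : R) : I ≤ powSaturation I x :=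
  fun y hy => ⟨0, by simpa using hy⟩

/-- The Krull boundary `xR + (I : x^∞)` of an element `x` modulo an ideal `I`. A prime containing
it is never minimal over `I`. -/
def boundaryIdeal (I : Ideal R) (x : R) : Ideal R :=
  Ideal.span {x} ⊔ powSaturation I x

theorem mem_boundaryIdeal {I : Ideal R} {x z : R} :
    z ∈ boundaryIdeal I x ↔ ∃ c y, (∃ k : ℕ, x ^ k * y ∈ I) ∧ z = x * c + y := by
  rw [boundaryIdeal, Submodule.mem_sup]
  constructor
  · rintro ⟨w, hw, y, hy, rfl⟩
    obtain ⟨c, rfl⟩ := Ideal.mem_span_singleton'.1 hw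
    exact ⟨c, y, hy, by ring⟩
  · rintro ⟨c, y, hy, rfl⟩
    exact ⟨x * c, Ideal.mem_span_singleton'.2 ⟨c, mul_comm _ _⟩, y, hy, rfl⟩

theorem le_boundaryIdeal (I : Ideal R) (x : R) : I ≤ boundaryIdeal I x :=
  (le_powSaturation I x).trans le_sup_right

/-- The boundary ideal obtained from `I` by taking boundaries along a list of elements, the head of
the list first. -/
def iterBoundary : Ideal R → List R → Ideal R
  | I, [] => I
  | I, x :: xs => iterBoundary (boundaryIdeal I x) xs

/-- The elements of a minimal prime over `I` become nilpotent modulo `I` in the localization. -/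
theorem exists_mul_pow_mem_of_mem_minimalPrimes {I p : Ideal R} (hp : p ∈ I.minimalPrimes) {x : R}
    (hx : x ∈ p) : ∃ s ∉ p, ∃ k : ℕ, s * x ^ k ∈ I := by
  have := hp.1.1
  by_contra! hc
  let M : Submonoid R := p.primeCompl ⊔ Submonoid.powers x
  have hdisj : Disjoint (I : Set R) (M : Set R) := by
    rw [Set.disjoint_left]
    intro z hz hzM
    obtain ⟨s, hs, y, ⟨k, rfl⟩, rfl⟩ := Submonoid.mem_sup.1 hzM
    exact hc s hs k hz
  obtain ⟨p', hp', hI, hd⟩ := Ideal.exists_le_prime_disjoint I M hdisj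
  have hle : p' ≤ p := fun z hz => by
    by_contra hzp
    exact Set.disjoint_left.1 hd hz (Submonoid.mem_sup_left (T := Submonoid.powers x) hzp)
  exact Set.disjoint_left.1 hd (hp.2 ⟨hp', hI⟩ hle hx)
    (Submonoid.mem_sup_right (S := p.primeCompl) (Submonoid.mem_powers x))

/-- A prime `p` containing the boundary of `x` modulo `I` strictly contains a prime over `I`. -/
theorem exists_lt_of_boundaryIdeal_le {I : Ideal R} {x : R} {p : Ideal R} [p.IsPrime]
    (h : boundaryIdeal I x ≤ p) : ∃ p' : Ideal R, p'.IsPrime ∧ I ≤ p' ∧ p' < p := by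
  obtain ⟨p', hp', hle⟩ := Ideal.exists_minimalPrimes_le ((le_boundaryIdeal I x).trans h)
  refine ⟨p', hp'.1.1, hp'.1.2, lt_of_le_of_ne hle ?_⟩
  rintro rfl
  have hx : x ∈ p' := h (le_sup_left (a := Ideal.span {x}) (Ideal.mem_span_singleton_self x))
  -- a minimal prime over `I` that contains `x` cannot contain `(I : x^∞)`
  obtain ⟨s, hs, k, hk⟩ := exists_mul_pow_mem_of_mem_minimalPrimes hp' hx
  exact hs (h (le_sup_right (a := Ideal.span {x}) ⟨k, by simpa [mul_comm] using hk⟩))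

/-- A prime containing an iterated boundary lies above a chain of primes as long as the list: each
boundary allows one further step down. -/
theorem iterBoundary_le_exists_height (I : Ideal R) (xs : List R) (q : Ideal R) [q.IsPrime]
    (h : iterBoundary I xs ≤ q) :
    ∃ p : Ideal R, p.IsPrime ∧ I ≤ p ∧ p.height + xs.length ≤ q.height := by
  induction xs generalizing I with
  | nil => exact ⟨q, inferInstance, h, by simp⟩
  | cons x xs ih =>
    obtain ⟨p, hp, hIp, hle⟩ := ih _ h
    obtain ⟨p', hp', hIp', hlt⟩ := exists_lt_of_boundaryIdeal_le hIp
    refine ⟨p', hp', hIp', le_trans ?_ hle⟩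
    have := Ideal.height_add_one_le_of_lt_of_isPrime hlt
    calc p'.height + ((x :: xs).length : ℕ) = (p'.height + 1) + xs.length := by
          rw [List.length_cons]; push_cast; ring
      _ ≤ _ := by gcongr

/-- A prime of height smaller than the length of a list does not contain the iterated boundary of
the zero ideal along that list. -/
theorem exists_mem_iterBoundary_notMem (xs : List R) (q : Ideal R) [q.IsPrime]
    (h : q.height < xs.length) : ∃ s ∈ iterBoundary (⊥ : Ideal R) xs, s ∉ q := by
  by_contra! hc
  obtain ⟨p, -, -, hle⟩ := iterBoundary_le_exists_height ⊥ xs q hc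
  exact absurd h (not_lt.2 (le_trans le_add_self hle))

theorem boundaryIdeal_eq_of_associated (I : Ideal R) {x y : R} (h : Associated x y) :
    boundaryIdeal I x = boundaryIdeal I y := by
  obtain ⟨u, rfl⟩ := h
  have h1 : Ideal.span {x} = Ideal.span {x * (u : R)} :=
    (Ideal.span_singleton_mul_right_unit u.isUnit x).symm
  rw [boundaryIdeal, boundaryIdeal, ← h1]
  congr 1
  ext z
  simp only [mem_powSaturation]
  refine exists_congr fun k => ?_
  have : (x * (u : R)) ^ k * z = (u : R) ^ k * (x ^ k * z) := by ring
  rw [this]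
  exact (Ideal.unit_mul_mem_iff_mem I (u.isUnit.pow k)).symm

theorem iterBoundary_eq_of_associated (I : Ideal R) {xs ys : List R}
    (h : List.Forall₂ Associated xs ys) : iterBoundary I xs = iterBoundary I ys := by
  induction h generalizing I with
  | nil => rfl
  | cons hxy _ ih => rw [iterBoundary, iterBoundary, boundaryIdeal_eq_of_associated I hxy, ih]

/-- Iterated boundaries along elements of the base ring are compatible with maps of algebras that are
merely linear, not ring homomorphisms. -/
theorem map_mem_iterBoundary {A B : Type*} [CommRing A] [CommRing B]
    {S : Type*} [CommRing S] [Algebra A B] [Algebra A S] (φ : B →ₗ[A] S) (xs : List A)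
    (I : Ideal B) (J : Ideal S) (hφ : ∀ b ∈ I, φ b ∈ J) (b : B)
    (hb : b ∈ iterBoundary I (xs.map (algebraMap A B))) :
    φ b ∈ iterBoundary J (xs.map (algebraMap A S)) := by
  induction xs generalizing I J with
  | nil => exact hφ b hb
  | cons x xs ih =>
    refine ih (boundaryIdeal I (algebraMap A B x)) (boundaryIdeal J (algebraMap A S x)) ?_ hb
    intro z hz
    obtain ⟨c, y, ⟨k, hk⟩, rfl⟩ := mem_boundaryIdeal.1 hz
    refine mem_boundaryIdeal.2 ⟨φ c, φ y, ⟨k, ?_⟩, ?_⟩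
    · have := hφ _ hk
      rwa [← map_pow, ← Algebra.smul_def, map_smul, Algebra.smul_def, map_pow] at this
    · rw [map_add, ← Algebra.smul_def, map_smul, Algebra.smul_def]

end Boundary

/-! ### Regular sequences modulo an ideal -/

section Regular

variable {R : Type*} [CommRing R]

/-- `xs` is a weakly regular sequence on `R ⧸ I`, expressed through ideals of `R`. -/
def IsRegularModulo : Ideal R → List R → Prop
  | _, [] => True
  | I, x :: xs => (∀ z, x * z ∈ I → z ∈ I) ∧ IsRegularModulo (I ⊔ Ideal.span {x}) xs

theorem mem_sup_span_singleton {I : Ideal R} {x z : R} :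
    z ∈ I ⊔ Ideal.span {x} ↔ ∃ i ∈ I, ∃ c, z = i + x * c := by
  rw [Submodule.mem_sup]
  constructor
  · rintro ⟨i, hi, w, hw, rfl⟩
    obtain ⟨c, rfl⟩ := Ideal.mem_span_singleton'.1 hw
    exact ⟨i, hi, c, by ring⟩
  · rintro ⟨i, hi, c, rfl⟩
    exact ⟨i, hi, x * c, Ideal.mem_span_singleton'.2 ⟨c, mul_comm _ _⟩, rfl⟩

theorem IsRegularModulo.of_forall_take (I : Ideal R) (xs : List R)
    (h : ∀ (i : ℕ) (hi : i < xs.length) (z : R),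
      xs[i] * z ∈ I ⊔ Ideal.ofList (xs.take i) → z ∈ I ⊔ Ideal.ofList (xs.take i)) :
    IsRegularModulo I xs := by
  induction xs generalizing I with
  | nil => trivial
  | cons x xs ih =>
    refine ⟨fun z hz => ?_, ih _ fun i hi z hz => ?_⟩
    · simpa using h 0 (by simp) z (by simpa using hz)
    · have := h (i + 1) (by simpa using hi) z
      simp only [List.getElem_cons_succ, List.take_succ_cons, Ideal.ofList_cons, ← sup_assoc]
        at this
      exact this hz

theorem IsRegularModulo.of_isWeaklyRegular {xs : List R}
    (h : RingTheory.Sequence.IsWeaklyRegular R xs) : IsRegularModulo (⊥ : Ideal R) xs := by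
  refine .of_forall_take _ _ fun i hi z hz => ?_
  have hJ : (Ideal.ofList (xs.take i) • ⊤ : Submodule R R) = Ideal.ofList (xs.take i) := by
    simp
  rw [bot_sup_eq, ← hJ] at hz ⊢
  have h1 := (h.regular_mod_prev i hi).right_eq_zero_of_smul
    (x := Submodule.Quotient.mk z) ((Submodule.Quotient.mk_eq_zero _).2 hz)
  exact (Submodule.Quotient.mk_eq_zero _).1 h1

/-- Weak regularity passes to the middle of the exact sequence
`0 → R ⧸ (I : x) → R ⧸ I → R ⧸ (I + xR) → 0`. -/
theorem IsRegularModulo.of_quotient_sub {I K : Ideal R} {x : R} {ys : List R}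
    (hK : ∀ z, z ∈ K ↔ x * z ∈ I) (h1 : IsRegularModulo K ys)
    (h2 : IsRegularModulo (I ⊔ Ideal.span {x}) ys) : IsRegularModulo I ys := by
  induction ys generalizing I K with
  | nil => trivial
  | cons y ys ih =>
    have key : ∀ z, y * z ∈ I ⊔ Ideal.span {x} → z ∈ I ⊔ Ideal.span {x} := h2.1
    refine ⟨fun z hz => ?_, ih (K := K ⊔ Ideal.span {y}) (fun z => ?_) h1.2 ?_⟩
    · obtain ⟨i, hi, w, rfl⟩ := mem_sup_span_singleton.1 (key z (Ideal.mem_sup_left hz))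
      refine I.add_mem hi ((hK _).1 (h1.1 w ((hK _).2 ?_)))
      have : x * (y * w) = y * (i + x * w) - y * i := by ring
      rw [this]
      exact I.sub_mem hz (I.mul_mem_left _ hi)
    · constructor
      · intro hz
        obtain ⟨i, hi, c, rfl⟩ := mem_sup_span_singleton.1 hz
        exact mem_sup_span_singleton.2 ⟨x * i, (hK i).1 hi, x * c, by ring⟩
      · intro hz
        obtain ⟨i, hi, v, hv⟩ := mem_sup_span_singleton.1 hz
        obtain ⟨j, hj, w, rfl⟩ := mem_sup_span_singleton.1
          (key v (mem_sup_span_singleton.2 ⟨-i, I.neg_mem hi, z, by rw [hv]; ring⟩))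
        refine mem_sup_span_singleton.2 ⟨z - y * w, (hK _).2 ?_, w, by ring⟩
        have : x * (z - y * w) = i + y * j := by rw [mul_sub, hv]; ring
        rw [this]
        exact I.add_mem hi (I.mul_mem_left _ hj)
    · have := h2.2
      rwa [sup_right_comm] at this

theorem IsRegularModulo.pow_head {I : Ideal R} {x : R} {xs : List R}
    (h : IsRegularModulo I (x :: xs)) (n : ℕ) :
    IsRegularModulo (I ⊔ Ideal.span {x ^ (n + 1)}) xs := by
  induction n with
  | zero => simpa using h.2
  | succ n ih =>
    refine .of_quotient_sub (K := I ⊔ Ideal.span {x ^ (n + 1)}) (x := x) (fun z => ?_) ih ?_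
    · constructor
      · intro hz
        obtain ⟨i, hi, c, rfl⟩ := mem_sup_span_singleton.1 hz
        exact mem_sup_span_singleton.2 ⟨x * i, I.mul_mem_left _ hi, c, by ring⟩
      · intro hz
        obtain ⟨i, hi, c, hc⟩ := mem_sup_span_singleton.1 hz
        refine mem_sup_span_singleton.2 ⟨z - x ^ (n + 1) * c, h.1 _ ?_, c, by ring⟩
        have : x * (z - x ^ (n + 1) * c) = i := by rw [mul_sub, hc]; ring
        rwa [this]
    · have hle : Ideal.span {x ^ (n + 1 + 1)} ≤ Ideal.span {x} :=
        Ideal.span_singleton_le_span_singleton.2 (dvd_pow_self x (by omega))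
      rw [sup_assoc, sup_eq_right.2 hle]
      exact h.2

/-- Along powers of a sequence that is regular modulo `I`, saturating changes nothing, so the
iterated boundary of `I` is generated by `I` and these powers. -/
theorem iterBoundary_pow_le {I m : Ideal R} {xs : List R} (h : IsRegularModulo I xs)
    (hm : ∀ x ∈ xs, x ∈ m) (n : ℕ) :
    iterBoundary I (xs.map (· ^ (n + 1))) ≤ I ⊔ m ^ (n + 1) := by
  -- powers of the head may replace the head, but the tail is only regular modulo these powers
  induction xs generalizing I with
  | nil => exact le_sup_left
  | cons x xs ih =>
    have hsat : ∀ k z, x ^ k * z ∈ I → z ∈ I := by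
      intro k
      induction k with
      | zero => simp
      | succ k ihk =>
        intro z hz
        refine ihk z (h.1 _ ?_)
        rwa [← mul_assoc, ← pow_succ']
    have hb : boundaryIdeal I (x ^ (n + 1)) = I ⊔ Ideal.span {x ^ (n + 1)} := by
      refine le_antisymm (sup_le le_sup_right ?_) (sup_le (le_boundaryIdeal _ _) le_sup_left)
      rintro z ⟨k, hk⟩
      rw [← pow_mul] at hk
      exact Ideal.mem_sup_left (hsat _ z hk)
    have hx : Ideal.span {x ^ (n + 1)} ≤ m ^ (n + 1) :=
      (Ideal.span_singleton_le_iff_mem _).2 (Ideal.pow_mem_pow (hm x (by simp)) _)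
    rw [List.map_cons, iterBoundary, hb]
    refine (ih (h.pow_head n) fun y hy => hm y (by simp [hy])).trans ?_
    rw [sup_assoc, sup_eq_right.2 hx]

end Regular

/-! ### Heights of primes in a fractional finite extension of a Cohen-Macaulay ring -/

section Height

/-- A Noetherian local ring whose depth equals its dimension has a regular sequence of that
length: the supremum defining the depth is attained. -/
theorem exists_isRegular_length_eq (S : Type u) [CommRing S] [IsLocalRing S] [IsNoetherianRing S]
    (h : localDepth S = ringKrullDim S) :
    ∃ rs : List S, (∀ r ∈ rs, r ∈ IsLocalRing.maximalIdeal S) ∧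
      RingTheory.Sequence.IsWeaklyRegular S rs ∧ (rs.length : WithBot ℕ∞) = ringKrullDim S := by
  obtain ⟨d, hd⟩ : ∃ d : ℕ, ringKrullDim S = d := by
    rw [← IsLocalRing.maximalIdeal_height_eq_ringKrullDim]
    obtain ⟨d, hd⟩ := ENat.ne_top_iff_exists.1
      (Ideal.height_ne_top_of_isPrime (I := IsLocalRing.maximalIdeal S))
    exact ⟨d, by rw [← hd]; rfl⟩
  rw [hd] at h ⊢
  by_contra! hc
  have hlt : ∀ rs : List S, ((∀ r ∈ rs, r ∈ IsLocalRing.maximalIdeal S) ∧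
      RingTheory.Sequence.IsRegular S rs) → rs.length < d := by
    intro rs hrs
    have h1 : ((rs.length : ℕ∞) : WithBot ℕ∞) ≤ localDepth S :=
      le_iSup₂_of_le rs hrs le_rfl
    rw [h] at h1
    have h2 : rs.length ≤ d := by exact_mod_cast h1
    refine lt_of_le_of_ne h2 fun he => hc rs hrs.1 hrs.2.toIsWeaklyRegular ?_
    rw [he]
  rcases d with _ | d
  · refine absurd (hlt [] ⟨by simp, ?_⟩) (by simp)
    exact RingTheory.Sequence.IsRegular.nil S S
  · have h1 : localDepth S ≤ (d : ℕ) := by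
      refine iSup₂_le fun rs hrs => ?_
      have := hlt rs hrs
      exact_mod_cast Nat.lt_succ_iff.1 this
    rw [h] at h1
    have : d + 1 ≤ d := by exact_mod_cast h1
    omega

theorem height_le_height_comap_of_isIntegral {A B : Type*} [CommRing A] [CommRing B] [Algebra A B]
    [Algebra.IsIntegral A B] (q : Ideal B) [q.IsPrime] :
    q.height ≤ (q.comap (algebraMap A B)).height := by
  have hmono : StrictMono (PrimeSpectrum.comap (algebraMap A B)) := fun I J hIJ =>
    Ideal.IsIntegral.comap_lt_comap (R := A) (I := I.asIdeal) (J := J.asIdeal) hIJ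
  have := Order.height_le_height_apply_of_strictMono _ hmono ⟨q, inferInstance⟩
  rwa [← PrimeSpectrum.height_eq_orderHeight, ← PrimeSpectrum.height_eq_orderHeight] at this

/-- Suppose that an element `a`, regular on `B`, multiplies `B` into the image of `A`, by a linear map
`φ : B → A`. If the height of `q` were smaller than the length of a regular sequence in `A_p`,
comparing iterated boundaries in `B` and in `A_p` would put `a` into all powers of the maximal ideal of
`B_q`, against Krull's intersection theorem. -/
theorem height_le_height_of_isRegular {A B S : Type*} [CommRing A] [CommRing B] [CommRing S]
    [IsNoetherianRing B] [Algebra A B] [Algebra A S] (φ : B →ₗ[A] A) (a : A)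
    (hφ : ∀ b, algebraMap A B (φ b) = a • b) (ha : ∀ b : B, a • b = 0 → b = 0)
    (q : Ideal B) [q.IsPrime] (p : Ideal A) [p.IsPrime] (hpq : q.comap (algebraMap A B) = p)
    [IsLocalization.AtPrime S p] [IsLocalRing S] (rs : List S)
    (hrs : ∀ r ∈ rs, r ∈ IsLocalRing.maximalIdeal S)
    (hreg : RingTheory.Sequence.IsWeaklyRegular S rs) : (rs.length : ℕ∞) ≤ q.height := by
  by_contra! hlt
  have hnum : ∀ r : S, ∃ x : A, Associated (algebraMap A S x) r := by
    intro r
    obtain ⟨⟨x, s⟩, hx⟩ := IsLocalization.surj p.primeCompl r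
    obtain ⟨v, hv⟩ := IsLocalization.map_units S s
    exact ⟨x, (Associated.symm ⟨v, by rw [hv]; exact hx⟩)⟩
  choose g hg using hnum
  -- an element outside `q` whose multiple by `a` lies in an arbitrarily high power of `q`
  have key : ∀ n : ℕ, ∃ s ∉ q, algebraMap A B a * s ∈ q ^ (n + 1) := by
    intro n
    let xs : List A := rs.map fun r => g r ^ (n + 1)
    obtain ⟨s, hs, hsq⟩ := exists_mem_iterBoundary_notMem (xs.map (algebraMap A B)) q
      (by simpa [xs] using hlt)
    have h1 := map_mem_iterBoundary (Algebra.linearMap A S ∘ₗ φ) xs ⊥ ⊥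
      (fun b hb => by rw [(Submodule.mem_bot B).1 hb, map_zero]; exact zero_mem _) s hs
    have h2 : List.Forall₂ Associated (xs.map (algebraMap A S)) (rs.map (· ^ (n + 1))) := by
      simp only [xs, List.map_map, List.forall₂_map_left_iff, List.forall₂_map_right_iff]
      refine List.forall₂_same.2 fun r _ => ?_
      simpa using (hg r).pow_pow
    rw [iterBoundary_eq_of_associated _ h2] at h1
    have h3 := iterBoundary_pow_le (.of_isWeaklyRegular hreg) hrs n h1
    rw [bot_sup_eq, ← IsLocalization.AtPrime.map_eq_maximalIdeal p S, ← Ideal.map_pow] at h3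
    obtain ⟨u, hu, hus⟩ := (IsLocalization.algebraMap_mem_map_algebraMap_iff p.primeCompl S
      (p ^ (n + 1)) (φ s)).1 h3
    refine ⟨algebraMap A B u * s, fun h => ?_, ?_⟩
    · rcases Ideal.IsPrime.mem_or_mem ‹q.IsPrime› h with h | h
      · exact hu (by rw [← hpq]; exact h)
      · exact hsq h
    · have h4 : algebraMap A B (u * φ s) ∈ (p ^ (n + 1)).map (algebraMap A B) :=
        Ideal.mem_map_of_mem _ hus
      rw [Ideal.map_pow] at h4
      have h5 : p.map (algebraMap A B) ≤ q := Ideal.map_le_iff_le_comap.2 hpq.ge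
      have h6 := Ideal.pow_right_mono h5 (n + 1) h4
      rw [map_mul, hφ, Algebra.smul_def] at h6
      rwa [mul_left_comm]
  let L := Localization.AtPrime q
  have hzero : algebraMap B L (algebraMap A B a) = 0 := by
    rw [← Ideal.mem_bot, ← Ideal.iInf_pow_eq_bot_of_isLocalRing (IsLocalRing.maximalIdeal L)
      (IsLocalRing.maximalIdeal.isMaximal L).ne_top, Ideal.mem_iInf]
    intro n
    obtain ⟨s, hs, hmem⟩ := key n
    have h1 : algebraMap B L (algebraMap A B a * s) ∈ IsLocalRing.maximalIdeal L ^ (n + 1) := by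
      rw [← IsLocalization.AtPrime.map_eq_maximalIdeal q L, ← Ideal.map_pow]
      exact Ideal.mem_map_of_mem _ hmem
    rw [map_mul, mul_comm] at h1
    have h2 : IsUnit (algebraMap B L s) := IsLocalization.map_units L (⟨s, hs⟩ : q.primeCompl)
    exact Ideal.pow_le_pow_right (Nat.le_succ n) ((Ideal.unit_mul_mem_iff_mem _ h2).1 h1)
  obtain ⟨t, ht⟩ := (IsLocalization.map_eq_zero_iff q.primeCompl L _).1 hzero
  refine t.2 ?_
  rw [ha t.1 (by rw [Algebra.smul_def, mul_comm]; exact ht)]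
  exact q.zero_mem

end Height

/-! ### Stalks of inverse image sheaves -/

section Stalk

open TopCat Opposite

variable {T X : TopCat.{u}} (g : T ⟶ X)

/-- The map on stalks `F_{g t} ⟶ G_t` induced by a morphism `F ⟶ g_* G`. -/
noncomputable def adjStalkMap {F : X.Presheaf CommRingCat.{u}} {G : T.Presheaf CommRingCat.{u}}
    (v : F ⟶ (Presheaf.pushforward CommRingCat.{u} g).obj G) (t : T) :
    F.stalk (g t) ⟶ G.stalk t :=
  (Presheaf.stalkFunctor CommRingCat.{u} (g t)).map v ≫
    Presheaf.stalkPushforward CommRingCat.{u} g G t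

theorem germ_adjStalkMap {F : X.Presheaf CommRingCat.{u}} {G : T.Presheaf CommRingCat.{u}}
    (v : F ⟶ (Presheaf.pushforward CommRingCat.{u} g).obj G) (t : T) (U : Opens X) (hU : g t ∈ U) :
    F.germ U (g t) hU ≫ adjStalkMap g v t =
      v.app (op U) ≫ G.germ ((Opens.map g).obj U) t hU := by
  refine (Presheaf.stalkFunctor_map_germ_assoc U (g t) hU v _).trans ?_
  exact congrArg (fun w => v.app (op U) ≫ w) (Presheaf.stalkPushforward_germ _ g G U t hU)

theorem adjStalkMap_comp {F : X.Presheaf CommRingCat.{u}} {G H : T.Presheaf CommRingCat.{u}}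
    (v : F ⟶ (Presheaf.pushforward CommRingCat.{u} g).obj G) (θ : G ⟶ H) (t : T) :
    adjStalkMap g (v ≫ (Presheaf.pushforward CommRingCat.{u} g).map θ) t =
      adjStalkMap g v t ≫ (Presheaf.stalkFunctor CommRingCat.{u} t).map θ := by
  refine Presheaf.stalk_hom_ext _ fun U hU => ?_
  refine (germ_adjStalkMap g _ t U hU).trans ?_
  have h1 := germ_adjStalkMap g v t U hU
  have h2 := Presheaf.stalkFunctor_map_germ ((Opens.map g).obj U) t hU θ
  refine Eq.trans ?_ (Category.assoc _ _ _)
  refine Eq.trans ?_ (congrArg (· ≫ (Presheaf.stalkFunctor CommRingCat.{u} t).map θ) h1.symm)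
  refine Eq.trans ?_ (Category.assoc _ _ _).symm
  refine Eq.trans ?_ (congrArg (v.app (op U) ≫ ·) h2.symm)
  exact Category.assoc _ _ _

/-- The stalk of `g⁻¹ F` at `t` is the stalk of `F` at `g t`, through the unit of the adjunction
between inverse and direct images. -/
theorem isIso_adjStalkMap_unit (F : TopCat.Sheaf CommRingCat.{u} X) (t : T) :
    IsIso (adjStalkMap g (F := F.presheaf)
      (G := ((Sheaf.pullback CommRingCat.{u} g).obj F).presheaf)
      ((Sheaf.pullbackPushforwardAdjunction CommRingCat.{u} g).unit.app F).hom t) := by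
  let c := Functor.sheafPullbackConstruction.sheafAdjunctionContinuous (Opens.map g) CommRingCat.{u}
    (Opens.grothendieckTopology X) (Opens.grothendieckTopology T)
  let e := (Sheaf.pullbackIso CommRingCat.{u} g).app F
  let P := (Presheaf.pullback CommRingCat.{u} g).obj F.presheaf
  -- the sheaf-level unit is the presheaf-level unit followed by sheafification
  have hu : ((Sheaf.pullbackPushforwardAdjunction CommRingCat.{u} g).unit.app F) ≫
      (Sheaf.pushforward CommRingCat.{u} g).map e.hom = c.unit.app F :=
    Adjunction.unit_leftAdjointUniq_hom_app _ _ _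
  have hc : (c.unit.app F).hom = (Presheaf.pullbackPushforwardAdjunction CommRingCat.{u} g).unit.app
      F.presheaf ≫ (Presheaf.pushforward CommRingCat.{u} g).map
        (CategoryTheory.toSheafify (Opens.grothendieckTopology T) P) := by
    refine (Adjunction.map_restrictFullyFaithful_unit_app
      (L := Functor.sheafPullbackConstruction.sheafPullback (Opens.map g) CommRingCat.{u}
        (Opens.grothendieckTopology X) (Opens.grothendieckTopology T))
      (R := (Opens.map g).sheafPushforwardContinuous CommRingCat.{u}
        (Opens.grothendieckTopology X) (Opens.grothendieckTopology T))
      (((Opens.map g).op.lanAdjunction CommRingCat.{u}).comp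
        (sheafificationAdjunction (Opens.grothendieckTopology T) CommRingCat.{u}))
      (fullyFaithfulSheafToPresheaf _ _)
      (Functor.FullyFaithful.id _) (Iso.refl _) (Iso.refl _) F).trans ?_
    simp
    rfl
  have hu' : ((Sheaf.pullbackPushforwardAdjunction CommRingCat.{u} g).unit.app F).hom =
      ((Presheaf.pullbackPushforwardAdjunction CommRingCat.{u} g).unit.app F.presheaf ≫
        (Presheaf.pushforward CommRingCat.{u} g).map
          (CategoryTheory.toSheafify (Opens.grothendieckTopology T) P)) ≫
        (Presheaf.pushforward CommRingCat.{u} g).map e.inv.hom := by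
    have h := (Iso.eq_comp_inv ((Sheaf.pushforward CommRingCat.{u} g).mapIso e)).2 hu
    refine (congrArg InducedCategory.Hom.hom h).trans ?_
    exact congrArg (· ≫ (Presheaf.pushforward CommRingCat.{u} g).map e.inv.hom) hc
  have h1 : IsIso (adjStalkMap g (G := P)
      ((Presheaf.pullbackPushforwardAdjunction CommRingCat.{u} g).unit.app F.presheaf) t) :=
    (Presheaf.stalkPullbackIso CommRingCat.{u} g F.presheaf t).isIso_hom
  have h2 : IsIso ((Presheaf.stalkFunctor CommRingCat.{u} t).map
      (CategoryTheory.toSheafify (Opens.grothendieckTopology T) P)) :=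
    Presheaf.stalkFunctor_map_unit_toSheafify_isIso t CommRingCat.{u} P
  have h3 : IsIso e.inv.hom := 
    ⟨e.hom.hom, congrArg InducedCategory.Hom.hom e.inv_hom_id,
      congrArg InducedCategory.Hom.hom e.hom_inv_id⟩
  have h4 := adjStalkMap_comp g (F := F.presheaf) (G := P)
    ((Presheaf.pullbackPushforwardAdjunction CommRingCat.{u} g).unit.app F.presheaf)
    (CategoryTheory.toSheafify (Opens.grothendieckTopology T) P) t
  have h5 := adjStalkMap_comp g (F := F.presheaf)
    ((Presheaf.pullbackPushforwardAdjunction CommRingCat.{u} g).unit.app F.presheaf ≫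
      (Presheaf.pushforward CommRingCat.{u} g).map
        (CategoryTheory.toSheafify (Opens.grothendieckTopology T) P)) e.inv.hom t
  have h6 := (congrArg (fun w => adjStalkMap g (F := F.presheaf)
      (G := ((Sheaf.pullback CommRingCat.{u} g).obj F).presheaf) w t) hu').trans
    (h5.trans (congrArg (· ≫ (Presheaf.stalkFunctor CommRingCat.{u} t).map e.inv.hom) h4))
  have h7 : IsIso ((Presheaf.stalkFunctor CommRingCat.{u} t).map e.inv.hom) :=
    Functor.map_isIso _ _
  exact h6 ▸ IsIso.comp_isIso' (IsIso.comp_isIso' h1 h2) h7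

/-- The isomorphism between the stalk of `F` at `g t` and the stalk of `g⁻¹ F` at `t`. -/
noncomputable def unitStalkIso (F : TopCat.Sheaf CommRingCat.{u} X) (t : T) :
    F.presheaf.stalk (g t) ≅ ((Sheaf.pullback CommRingCat.{u} g).obj F).presheaf.stalk t :=
  @asIso _ _ _ _ _ (isIso_adjStalkMap_unit g F t)

theorem germ_unitStalkIso_hom (F : TopCat.Sheaf CommRingCat.{u} X) (t : T) (U : Opens X)
    (hU : g t ∈ U) :
    F.presheaf.germ U (g t) hU ≫ (unitStalkIso g F t).hom =
      ((Sheaf.pullbackPushforwardAdjunction CommRingCat.{u} g).unit.app F).hom.app (op U) ≫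
        ((Sheaf.pullback CommRingCat.{u} g).obj F).presheaf.germ ((Opens.map g).obj U) t hU :=
  germ_adjStalkMap g (F := F.presheaf) _ t U hU

end Stalk

/-! ### Values of rational functions at associated points -/

section Rational

open TopCat Opposite

variable (X : Scheme.{u})

/-- The value of a rational function at an associated point `x`, as an element of the local ring
at `x`. -/
noncomputable def ratValue (U : X.Opens) (x : X) (hx : x ∈ assPoints X) (hxU : x ∈ U) :
    (ratSheaf X).presheaf.obj (op U) ⟶ X.presheaf.stalk x :=
  ((Sheaf.pullback CommRingCat.{u} (assInclusion X)).obj X.sheaf).presheaf.germ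
      ((Opens.map (assInclusion X)).obj U) ⟨x, hx⟩ hxU ≫
    (unitStalkIso (assInclusion X) X.sheaf ⟨x, hx⟩).inv

/-- The rational function on `U` defined by a regular function on `U`. -/
noncomputable def toRat (U : X.Opens) : Γ(X, U) ⟶ (ratSheaf X).presheaf.obj (op U) :=
  (toRatSheaf X).hom.app (op U)

theorem toRat_ratValue (U : X.Opens) (x : X) (hx : x ∈ assPoints X) (hxU : x ∈ U) :
    toRat X U ≫ ratValue X U x hx hxU = X.presheaf.germ U x hxU := by
  refine (Category.assoc _ _ _).symm.trans ((Iso.comp_inv_eq _).2 ?_)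
  exact (germ_unitStalkIso_hom (assInclusion X) X.sheaf ⟨x, hx⟩ U hxU).symm

/-- A rational function is determined by its values at the associated points. -/
theorem ratValue_ext (U : X.Opens) (c d : (ratSheaf X).presheaf.obj (op U))
    (h : ∀ x (hx : x ∈ assPoints X) (hxU : x ∈ U),
      (ratValue X U x hx hxU).hom c = (ratValue X U x hx hxU).hom d) : c = d := by
  refine Presheaf.section_ext ((Sheaf.pullback CommRingCat.{u} (assInclusion X)).obj X.sheaf)
    ((Opens.map (assInclusion X)).obj U) c d fun t ht => ?_
  exact (ConcreteCategory.bijective_of_isIso (unitStalkIso (assInclusion X) X.sheaf t).inv).1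
    (h t.1 t.2 ht)

variable {X}

/-- A bifractional morphism identifies rational functions on `U` and on the preimage of `U`,
compatibly with regular functions. -/
theorem IsBifractional.exists_ringEquiv {Y : Scheme.{u}} {f : Y ⟶ X} (hf : IsBifractional f)
    (U : X.Opens) :
    ∃ e : (ratSheaf X).presheaf.obj (op U) ≃+* (ratSheaf Y).presheaf.obj (op (f ⁻¹ᵁ U)),
      ∀ s : Γ(X, U), e ((toRat X U).hom s) = (toRat Y (f ⁻¹ᵁ U)).hom ((f.app U).hom s) := by
  obtain ⟨ψ, hψ, hiso⟩ := hf
  let adj := Sheaf.pullbackPushforwardAdjunction CommRingCat.{u} f.base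
  let γ : ratSheaf X ⟶ (Sheaf.pushforward CommRingCat.{u} f.base).obj (ratSheaf Y) :=
    adj.homEquiv _ _ ψ
  have hγ : IsIso γ := hiso
  have hcomm : toRatSheaf X ≫ γ =
      structureMap f ≫ (Sheaf.pushforward CommRingCat.{u} f.base).map (toRatSheaf Y) := by
    have h1 := congrArg (adj.homEquiv _ _) hψ
    rw [adj.homEquiv_naturality_left, adj.homEquiv_naturality_right] at h1
    refine h1.trans ?_
    congr 1
    exact (adj.homEquiv _ _).apply_symm_apply _
  let i : (ratSheaf X).presheaf.obj (op U) ≅ (ratSheaf Y).presheaf.obj (op (f ⁻¹ᵁ U)) :=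
    { hom := γ.hom.app (op U)
      inv := (inv γ).hom.app (op U)
      hom_inv_id := congrArg (fun w => w.hom.app (op U)) (IsIso.hom_inv_id γ)
      inv_hom_id := congrArg (fun w => w.hom.app (op U)) (IsIso.inv_hom_id γ) }
  refine ⟨i.commRingCatIsoToRingEquiv, fun s => ?_⟩
  exact congrArg (fun w => (w.hom.app (op U)).hom s) hcomm

end Rational

/-! ### Associated primes and denominators -/

section AssociatedPrimes

variable {A : Type*} [CommRing A]

theorem exists_prime_eq_colon_forall_mul_ne_zero [IsNoetherianRing A] {s : A} (hs : s ≠ 0) :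
    ∃ P : Ideal A, P.IsPrime ∧ (∃ b : A, ∀ z, z ∈ P ↔ z * b = 0) ∧ ∀ u ∉ P, u * s ≠ 0 := by
  obtain ⟨P, hP, hle⟩ := exists_le_isAssociatedPrime_of_isNoetherianRing A s hs
  obtain ⟨hprime, b, hb⟩ := isAssociatedPrime_iff.1 hP
  refine ⟨P, hprime, ⟨b, fun z => ?_⟩, fun u hu hus => hu (hle ?_)⟩
  · rw [hb, Submodule.mem_colon_singleton]
    simp
  · rw [Submodule.mem_colon_singleton]
    simpa using hus

theorem maximalIdeal_mem_associatedPrimes_of_isLocalization {P : Ideal A} [P.IsPrime] {b : A}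
    (hb : ∀ z, z ∈ P ↔ z * b = 0) (S : Type*) [CommRing S] [Algebra A S]
    [IsLocalization.AtPrime S P] [IsLocalRing S] [IsNoetherianRing S] :
    IsLocalRing.maximalIdeal S ∈ associatedPrimes S S := by
  refine isAssociatedPrime_iff.2 ⟨inferInstance, algebraMap A S b, ?_⟩
  refine ((IsLocalRing.maximalIdeal.isMaximal S).eq_of_le ?_ ?_)
  · rw [Ne, Ideal.eq_top_iff_one, Submodule.mem_colon_singleton]
    intro h
    rw [one_smul, Submodule.mem_bot, IsLocalization.map_eq_zero_iff P.primeCompl S] at h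
    obtain ⟨u, hu⟩ := h
    exact u.2 ((hb _).2 hu)
  · rw [← IsLocalization.AtPrime.map_eq_maximalIdeal P S, Ideal.map_le_iff_le_comap]
    intro z hz
    rw [Ideal.mem_comap, Submodule.mem_colon_singleton, smul_eq_mul, ← map_mul, (hb z).1 hz,
      map_zero]
    exact zero_mem _

theorem maximalIdeal_eq_bot_of_mem_associatedPrimes (S : Type*) [CommRing S] [IsLocalRing S]
    [IsNoetherianRing S] [_root_.IsReduced S]
    (h : IsLocalRing.maximalIdeal S ∈ associatedPrimes S S) : IsLocalRing.maximalIdeal S = ⊥ := by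
  obtain ⟨-, c, hc⟩ := isAssociatedPrime_iff.1 h
  have hmem : ∀ z, z ∈ IsLocalRing.maximalIdeal S ↔ z * c = 0 := fun z => by
    rw [hc, Submodule.mem_colon_singleton]
    simp
  -- an element `c` annihilated by the maximal ideal is not nilpotent, hence a unit
  have hunit : IsUnit c := by
    by_contra hn
    have h1 : c * c = 0 := (hmem c).1 ((IsLocalRing.mem_maximalIdeal c).2 hn)
    have h2 : c = 0 := IsReduced.eq_zero c ⟨2, by rw [pow_two, h1]⟩
    exact (IsLocalRing.maximalIdeal.isMaximal S).ne_top
      ((Ideal.eq_top_iff_one _).2 ((hmem 1).2 (by rw [h2, mul_zero])))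
  refine (Submodule.eq_bot_iff _).2 fun z hz => ?_
  exact (hunit.mul_left_eq_zero).1 ((hmem z).1 hz)

theorem mem_minimalPrimes_of_maximalIdeal_eq_bot (P : Ideal A) [P.IsPrime] (S : Type*)
    [CommRing S] [Algebra A S] [IsLocalization.AtPrime S P] [IsLocalRing S]
    (h : IsLocalRing.maximalIdeal S = ⊥) : P ∈ minimalPrimes A := by
  refine ⟨⟨inferInstance, bot_le⟩, fun P' hP' _ z hz => ?_⟩
  have h1 : algebraMap A S z ∈ IsLocalRing.maximalIdeal S := by
    rw [← IsLocalization.AtPrime.map_eq_maximalIdeal P S]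
    exact Ideal.mem_map_of_mem _ hz
  rw [h, Ideal.mem_bot, IsLocalization.map_eq_zero_iff P.primeCompl S] at h1
  obtain ⟨u, hu⟩ := h1
  have := hP'.1
  rcases this.mem_or_mem (hu ▸ P'.zero_mem : (u : A) * z ∈ P') with hu' | hz'
  · exact absurd (‹P' ≤ P› hu') u.2
  · exact hz'

/-- In a reduced Noetherian ring an ideal contained in no minimal prime contains a nonzerodivisor. -/
theorem exists_mem_nonZeroDivisors_of_forall_not_le [IsNoetherianRing A] [_root_.IsReduced A]
    (D : Ideal A) (h : ∀ P ∈ minimalPrimes A, ¬ D ≤ P) : ∃ a ∈ D, a ∈ nonZeroDivisors A := by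
  have hfin := minimalPrimes.finite_of_isNoetherianRing A
  by_contra! hc
  have hsub : (D : Set A) ⊆ ⋃ P ∈ (hfin.toFinset : Set (Ideal A)), (P : Set A) := by
    intro a ha
    by_contra hnot
    simp only [Set.mem_iUnion, not_exists, Set.Finite.coe_toFinset] at hnot
    refine hc a ha (mem_nonZeroDivisors_iff_right.2 fun z hz => ?_)
    have hnil : z ∈ sInf (minimalPrimes A) := by
      refine Ideal.mem_sInf.2 fun {P} hP => ?_
      exact (hP.1.1.mem_or_mem (hz ▸ P.zero_mem : z * a ∈ P)).resolve_right (hnot P hP)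
    rw [minimalPrimes, Ideal.sInf_minimalPrimes] at hnil
    obtain ⟨n, hn⟩ := hnil
    exact IsReduced.eq_zero z ⟨n, hn⟩
  obtain ⟨P, hP, hle⟩ := (Ideal.subset_union_prime (f := fun P => P) ⊥ ⊥
    (fun P hP _ _ => ((hfin.mem_toFinset.1 hP).1.1 : P.IsPrime))).1 hsub
  exact h P (hfin.mem_toFinset.1 hP) hle

/-- An element lying in all minimal primes except a given one. -/
theorem exists_notMem_forall_minimalPrimes_mem [IsNoetherianRing A] {P : Ideal A}
    (hP : P ∈ minimalPrimes A) :
    ∃ e ∉ P, ∀ P' ∈ minimalPrimes A, P' ≠ P → e ∈ P' := by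
  have hfin := minimalPrimes.finite_of_isNoetherianRing A
  have := hP.1.1
  let I : Ideal A := (hfin.toFinset.erase P).inf id
  have hI : ¬ I ≤ P := by
    intro hle
    obtain ⟨P', hP', hle'⟩ := (Ideal.IsPrime.inf_le' this).1 hle
    rw [Finset.mem_erase, hfin.mem_toFinset] at hP'
    exact hP'.1 (le_antisymm hle' (hP.2 hP'.2.1 hle'))
  obtain ⟨e, heI, heP⟩ := SetLike.not_le_iff_exists.1 hI
  refine ⟨e, heP, fun P' hP' hne => ?_⟩
  exact (Finset.inf_le (f := id) (Finset.mem_erase.2 ⟨hne, hfin.mem_toFinset.2 hP'⟩) : I ≤ P') heI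

/-- If every element of `Q` is a fraction with denominator in `M`, then a finitely generated module
mapping to `Q` has a common denominator, and multiplication by it is a linear map to `A`. -/
theorem exists_common_denominator {B Q : Type*} [AddCommGroup B] [Module A B] [Module.Finite A B]
    [CommRing Q] [Algebra A Q] (hinj : Function.Injective (algebraMap A Q)) (M : Submonoid A)
    (hden : ∀ c : Q, ∃ a ∈ M, ∃ r : A, algebraMap A Q r = a • c) (β : B →ₗ[A] Q) :
    ∃ a ∈ M, ∃ φ : B →ₗ[A] A, ∀ b, algebraMap A Q (φ b) = a • β b := by
  have key : ∀ N : Submodule A B, N.FG → ∃ a ∈ M, ∀ b ∈ N,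
      a • β b ∈ LinearMap.range (Algebra.linearMap A Q) := by
    intro N hN
    induction N, hN using Submodule.fg_induction with
    | singleton x =>
      obtain ⟨a, ha, r, hr⟩ := hden (β x)
      refine ⟨a, ha, fun b hb => ?_⟩
      obtain ⟨t, rfl⟩ := Submodule.mem_span_singleton.1 hb
      refine ⟨t * r, ?_⟩
      rw [Algebra.linearMap_apply, map_mul, hr, map_smul, ← Algebra.smul_def, smul_comm]
    | sup N₁ N₂ _ _ h₁ h₂ =>
      obtain ⟨a, ha, h₁⟩ := h₁
      obtain ⟨a', ha', h₂⟩ := h₂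
      refine ⟨a * a', M.mul_mem ha ha', fun b hb => ?_⟩
      obtain ⟨y, hy, z, hz, rfl⟩ := Submodule.mem_sup.1 hb
      rw [map_add, smul_add]
      refine add_mem ?_ ?_
      · rw [mul_comm, mul_smul]
        exact Submodule.smul_mem _ _ (h₁ y hy)
      · rw [mul_smul]
        exact Submodule.smul_mem _ _ (h₂ z hz)
  obtain ⟨a, ha, h⟩ := key ⊤ Module.Finite.fg_top
  refine ⟨a, ha, (LinearEquiv.ofInjective (Algebra.linearMap A Q) hinj).symm.toLinearMap ∘ₗ
    (a • β).codRestrict _ fun b => h b trivial, fun b => ?_⟩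
  exact congrArg Subtype.val
    ((LinearEquiv.ofInjective (Algebra.linearMap A Q) hinj).apply_symm_apply ⟨a • β b, h b trivial⟩)

end AssociatedPrimes

/-! ### Rational functions on affine open sets -/

section Affine

open Opposite

variable {X : Scheme.{u}} {U : X.Opens}

theorem primeIdealOf_injective (hU : IsAffineOpen U) {x y : U}
    (h : hU.primeIdealOf x = hU.primeIdealOf y) : x = y := by
  apply Subtype.ext
  rw [← hU.fromSpec_primeIdealOf x, h, hU.fromSpec_primeIdealOf]

theorem exists_primeIdealOf_eq (hU : IsAffineOpen U) (P : PrimeSpectrum Γ(X, U)) :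
    ∃ x : U, hU.primeIdealOf x = P :=
  hU.isoSpec.hom.surjective P

theorem germ_eq_zero_iff (hU : IsAffineOpen U) (x : U) (s : Γ(X, U)) :
    (X.presheaf.germ U x x.2).hom s = 0 ↔ ∃ t ∉ (hU.primeIdealOf x).asIdeal, t * s = 0 := by
  have := hU.isLocalization_stalk x
  refine (IsLocalization.map_eq_zero_iff (hU.primeIdealOf x).asIdeal.primeCompl
    (X.presheaf.stalk (x : X)) s).trans ?_
  exact ⟨fun ⟨t, ht⟩ => ⟨t, t.2, ht⟩, fun ⟨t, ht, h⟩ => ⟨⟨t, ht⟩, h⟩⟩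

theorem isUnit_germ_of_notMem (hU : IsAffineOpen U) (x : U) {s : Γ(X, U)}
    (hs : s ∉ (hU.primeIdealOf x).asIdeal) : IsUnit ((X.presheaf.germ U x x.2).hom s) := by
  have := hU.isLocalization_stalk x
  exact IsLocalization.map_units (M := (hU.primeIdealOf x).asIdeal.primeCompl)
    (X.presheaf.stalk (x : X)) ⟨s, hs⟩

theorem ratValue_toRat (x : X) (hx : x ∈ assPoints X) (hxU : x ∈ U) (s : Γ(X, U)) :
    (ratValue X U x hx hxU).hom ((toRat X U).hom s) = (X.presheaf.germ U x hxU).hom s :=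
  congrArg (fun w => w.hom s) (toRat_ratValue X U x hx hxU)

/-- On a locally Noetherian scheme regular functions embed into rational functions, as a nonzero
function has a nonzero germ at some associated point. -/
theorem toRat_injective [IsLocallyNoetherian X] (hU : IsAffineOpen U) :
    Function.Injective (toRat X U).hom := by
  rw [injective_iff_map_eq_zero]
  intro s hs
  have hN : IsNoetherianRing Γ(X, U) := IsLocallyNoetherian.component_noetherian ⟨U, hU⟩
  by_contra hne
  obtain ⟨P, hP, ⟨b, hb⟩, hPs⟩ := exists_prime_eq_colon_forall_mul_ne_zero hne
  obtain ⟨x, hx⟩ := exists_primeIdealOf_eq hU ⟨P, hP⟩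
  have hloc := hU.isLocalization_stalk x
  rw [hx] at hloc
  have hass : (x : X) ∈ assPoints X :=
    maximalIdeal_mem_associatedPrimes_of_isLocalization hb (X.presheaf.stalk (x : X))
  have h1 := ratValue_toRat x.1 hass x.2 s
  rw [hs, map_zero] at h1
  obtain ⟨t, ht, hts⟩ := (germ_eq_zero_iff hU x s).1 h1.symm
  rw [hx] at ht
  exact hPs t ht hts

theorem maximalIdeal_stalk_eq_bot [IsLocallyNoetherian X] [AlgebraicGeometry.IsReduced X] {x : X}
    (hx : x ∈ assPoints X) : IsLocalRing.maximalIdeal (X.presheaf.stalk x) = ⊥ :=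
  maximalIdeal_eq_bot_of_mem_associatedPrimes _ hx

theorem primeIdealOf_mem_minimalPrimes [IsLocallyNoetherian X] [AlgebraicGeometry.IsReduced X]
    (hU : IsAffineOpen U) (x : U) (hx : (x : X) ∈ assPoints X) :
    (hU.primeIdealOf x).asIdeal ∈ minimalPrimes Γ(X, U) := by
  have := hU.isLocalization_stalk x
  exact mem_minimalPrimes_of_maximalIdeal_eq_bot _ (X.presheaf.stalk (x : X))
    (maximalIdeal_stalk_eq_bot hx)

/-- A nonzerodivisor on a reduced scheme is invertible at the associated points, hence it is regular
on rational functions. -/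
theorem eq_zero_of_toRat_mul_eq_zero [IsLocallyNoetherian X] [AlgebraicGeometry.IsReduced X]
    (hU : IsAffineOpen U) {a : Γ(X, U)} (ha : a ∈ nonZeroDivisors Γ(X, U))
    (c : (ratSheaf X).presheaf.obj (op U)) (h : (toRat X U).hom a * c = 0) : c = 0 := by
  refine ratValue_ext X U c 0 fun x hx hxU => ?_
  have h1 := congrArg (ratValue X U x hx hxU).hom h
  rw [map_mul, ratValue_toRat, map_zero] at h1
  have h2 := isUnit_germ_of_notMem hU ⟨x, hxU⟩ (s := a) fun hmem =>
    notMem_nonZeroDivisors_of_mem_mem_minimalPrimes hmem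
      (primeIdealOf_mem_minimalPrimes hU ⟨x, hxU⟩ hx) ha
  rw [map_zero]
  exact (h2.mul_right_eq_zero).1 h1

/-- Near a given minimal prime `P`, a rational function is a fraction. An element outside `P` that
lies in all other minimal primes vanishes at all other associated points, which turns the local
denominator at `P` into a global one. -/
theorem exists_notMem_toRat_mul_eq [IsLocallyNoetherian X] [AlgebraicGeometry.IsReduced X]
    (hU : IsAffineOpen U) (c : (ratSheaf X).presheaf.obj (op U)) {P : Ideal Γ(X, U)}
    (hP : P ∈ minimalPrimes Γ(X, U)) :
    ∃ a ∉ P, ∃ r, (toRat X U).hom r = (toRat X U).hom a * c := by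
  have hN : IsNoetherianRing Γ(X, U) := IsLocallyNoetherian.component_noetherian ⟨U, hU⟩
  have hprime : P.IsPrime := hP.1.1
  obtain ⟨x, hx⟩ := exists_primeIdealOf_eq hU ⟨P, hprime⟩
  obtain ⟨e, heP, he⟩ := exists_notMem_forall_minimalPrimes_mem hP
  obtain ⟨s, hs, r, hr⟩ : ∃ s ∉ P, ∃ r, ∀ hass : (x : X) ∈ assPoints X,
      (X.presheaf.germ U x x.2).hom r =
        (X.presheaf.germ U x x.2).hom s * (ratValue X U x hass x.2).hom c := by
    by_cases hass : (x : X) ∈ assPoints X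
    · have hloc := hU.isLocalization_stalk x
      rw [hx] at hloc
      obtain ⟨⟨r, s⟩, hrs⟩ := IsLocalization.surj P.primeCompl ((ratValue X U x hass x.2).hom c)
      exact ⟨s, s.2, r, fun _ => hrs.symm.trans (mul_comm _ _)⟩
    · exact ⟨1, hprime.one_notMem, 0, fun h => absurd h hass⟩
  refine ⟨e * s, fun h => (hprime.mem_or_mem h).elim heP hs, e * r, ?_⟩
  refine ratValue_ext X U _ _ fun y hy hyU => ?_
  rw [map_mul (ratValue X U y hy hyU).hom, ratValue_toRat, ratValue_toRat, map_mul, map_mul]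
  by_cases hyx : (⟨y, hyU⟩ : U) = x
  · subst hyx
    rw [hr hy, mul_assoc]
  · have hmin := primeIdealOf_mem_minimalPrimes hU ⟨y, hyU⟩ hy
    have hmem := he _ hmin fun h => hyx (primeIdealOf_injective hU (PrimeSpectrum.ext (by rw [h, hx])))
    let := X.presheaf.algebra_section_stalk ⟨y, hyU⟩
    have hloc : IsLocalization.AtPrime (X.presheaf.stalk y) (hU.primeIdealOf ⟨y, hyU⟩).asIdeal :=
      hU.isLocalization_stalk ⟨y, hyU⟩
    have h0 : (X.presheaf.germ U y hyU).hom e ∈ IsLocalRing.maximalIdeal (X.presheaf.stalk y) := by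
      rw [← IsLocalization.AtPrime.map_eq_maximalIdeal (hU.primeIdealOf ⟨y, hyU⟩).asIdeal]
      exact Ideal.mem_map_of_mem _ hmem
    rw [maximalIdeal_stalk_eq_bot hy, Ideal.mem_bot] at h0
    rw [h0, zero_mul, zero_mul, zero_mul]

/-- On an affine open set of a reduced locally Noetherian scheme, rational functions are fractions of
regular functions with nonzerodivisors as denominators. -/
theorem exists_nonZeroDivisors_toRat_mul_eq [IsLocallyNoetherian X]
    [AlgebraicGeometry.IsReduced X] (hU : IsAffineOpen U)
    (c : (ratSheaf X).presheaf.obj (op U)) :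
    ∃ a ∈ nonZeroDivisors Γ(X, U), ∃ r, (toRat X U).hom r = (toRat X U).hom a * c := by
  have hN : IsNoetherianRing Γ(X, U) := IsLocallyNoetherian.component_noetherian ⟨U, hU⟩
  let D : Ideal Γ(X, U) :=
    { carrier := {a | ∃ r, (toRat X U).hom r = (toRat X U).hom a * c}
      zero_mem' := ⟨0, by rw [map_zero, zero_mul]⟩
      add_mem' := by
        rintro a b ⟨r, hr⟩ ⟨s, hs⟩
        exact ⟨r + s, by rw [map_add, map_add, hr, hs, add_mul]⟩
      smul_mem' := by
        rintro t a ⟨r, hr⟩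
        exact ⟨t * r, by rw [smul_eq_mul, map_mul, map_mul, hr, mul_assoc]⟩ }
  obtain ⟨a, haD, ha⟩ := exists_mem_nonZeroDivisors_of_forall_not_le D fun P hP hle => by
    obtain ⟨a, haP, haD⟩ := exists_notMem_toRat_mul_eq hU c hP
    exact haP (hle haD)
  exact ⟨a, ha, haD⟩

end Affine

/-! ### Dimension along the fibers -/

section Fibers

open Opposite

/-- Along a finite bifractional morphism to a reduced Cohen-Macaulay scheme, local rings have the
same dimension as the local rings at the image points. -/
theorem ringKrullDim_stalk_eq_of_isBifractional {X Y : Scheme.{u}} [IsCohenMacaulayScheme X]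
    [AlgebraicGeometry.IsReduced X] [IsLocallyNoetherian Y] (f : Y ⟶ X) [IsFinite f]
    (hf : IsBifractional f) (y : Y) :
    ringKrullDim (Y.presheaf.stalk y) = ringKrullDim (X.presheaf.stalk (f y)) := by
  obtain ⟨U, hU, hxU, -⟩ := exists_isAffineOpen_mem_and_subset (X := X) (x := f y) (U := ⊤) trivial
  have hV : IsAffineOpen (f ⁻¹ᵁ U) := hU.preimage f
  have hNB : IsNoetherianRing Γ(Y, f ⁻¹ᵁ U) :=
    IsLocallyNoetherian.component_noetherian ⟨f ⁻¹ᵁ U, hV⟩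
  algebraize [(f.app U).hom, (toRat X U).hom]
  have hfin : Module.Finite Γ(X, U) Γ(Y, f ⁻¹ᵁ U) := IsFinite.finite_app f U hU
  obtain ⟨e, he⟩ := hf.exists_ringEquiv U
  -- the coordinate ring of the preimage embeds into the rational functions on `U`
  let β : Γ(Y, f ⁻¹ᵁ U) →ₗ[Γ(X, U)] (ratSheaf X).presheaf.obj (op U) :=
    { toFun := fun b => e.symm ((toRat Y (f ⁻¹ᵁ U)).hom b)
      map_add' := fun b b' => by rw [map_add, map_add]
      map_smul' := fun r b => by
        rw [RingHom.id_apply, Algebra.smul_def, Algebra.smul_def, map_mul, map_mul]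
        congr 1
        rw [RingEquiv.symm_apply_eq]
        exact (he r).symm }
  have hβ : Function.Injective β := e.symm.injective.comp (toRat_injective hV)
  obtain ⟨a, ha, φ, hφ⟩ := exists_common_denominator (toRat_injective hU)
    (nonZeroDivisors Γ(X, U)) (fun c => by
      obtain ⟨a, ha, r, hr⟩ := exists_nonZeroDivisors_toRat_mul_eq hU c
      exact ⟨a, ha, r, hr.trans (Algebra.smul_def a c).symm⟩) β
  let q := (hV.primeIdealOf ⟨y, hxU⟩).asIdeal
  let p := (hU.primeIdealOf ⟨f y, hxU⟩).asIdeal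
  have hpq : q.comap (algebraMap Γ(X, U) Γ(Y, f ⁻¹ᵁ U)) = p := by
    have := IsAffineOpen.comap_primeIdealOf_appLE U hU (f ⁻¹ᵁ U) hV le_rfl hxU
    rw [Scheme.Hom.appLE_eq_app] at this
    exact congrArg PrimeSpectrum.asIdeal this
  let := X.presheaf.algebra_section_stalk ⟨f y, hxU⟩
  let := Y.presheaf.algebra_section_stalk (U := f ⁻¹ᵁ U) ⟨y, hxU⟩
  have hlocp : IsLocalization.AtPrime (X.presheaf.stalk (f y)) p :=
    hU.isLocalization_stalk ⟨f y, hxU⟩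
  have hlocq : IsLocalization.AtPrime (Y.presheaf.stalk y) q :=
    hV.isLocalization_stalk ⟨y, hxU⟩
  rw [IsLocalization.AtPrime.ringKrullDim_eq_height q (Y.presheaf.stalk y)]
  refine le_antisymm ?_ ?_
  · rw [IsLocalization.AtPrime.ringKrullDim_eq_height p (X.presheaf.stalk (f y)), ← hpq]
    exact WithBot.coe_le_coe.2 (height_le_height_comap_of_isIntegral q)
  · obtain ⟨rs, hrs, hreg, hlen⟩ := exists_isRegular_length_eq (X.presheaf.stalk (f y))
      (IsCohenMacaulayScheme.depth_eq_dim (f y))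
    rw [← hlen]
    refine WithBot.coe_le_coe.2 (height_le_height_of_isRegular φ a (fun b => hβ ?_)
      (fun b hb => hβ ?_) q p hpq rs hrs hreg)
    · rw [map_smul, ← hφ b]
      change e.symm _ = _
      rw [RingEquiv.symm_apply_eq]
      exact (he (φ b)).symm
    · rw [map_zero]
      refine eq_zero_of_toRat_mul_eq_zero hU ha _ ?_
      have := congrArg β hb
      rwa [map_smul, map_zero, Algebra.smul_def] at this

end Fibers

theorem mainTheorem5 {X Y : Scheme.{u}} [IsCohenMacaulayScheme X] [AlgebraicGeometry.IsReduced X]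
    [IsLocallyNoetherian Y] (f : Y ⟶ X) [IsFinite f] (hf : IsBifractional f) :
    IsEquidimAlongClosedFibers f := by
  rintro x - y y' rfl hy'
  rw [ringKrullDim_stalk_eq_of_isBifractional f hf y,
    ringKrullDim_stalk_eq_of_isBifractional f hf y', hy']
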